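/- Let $\mathscr H$ be a (real or complex) Hilbert space with scalar field $\mathbb K$ and let $H$ be a Hermitian, possibly unbounded, operator on $\mathscr H$ with spectral resolution $P$: $P$ is a projection-valued measure on the Borel sets of $\mathbb R$, $H=\int\lambda\,dP(\lambda)$, and $D(H)=\{x:\int\lambda^2\,d\langle x,P(\lambda)x\rangle<\infty\}$. Point and continuous spectrum may be mixed. Let $v_1,\dots,v_M\in D(H)$ be guess vectors and $V=[v_1,\dots,v_M]:\mathbb K^M\to\mathscr H$. For a Borel set $I\subset\mathbb R$ let $V I=P(I)V$. For $W=[w_1,\dots,w_M]$ with $w_l\in D(H)$ write $W^2=W^\dagger W$ for the Gram matrix, $\lambda_{m^*}(W^2)$ for its smallest non-zero eigenvalue, and $\mu_1(W)\ge\dots\ge\mu_m(W)$, $m=\operatorname{rank}W^2$, for the proper eigenvalues, with multiplicity, of the generalized eigenvalue problem $W^\dagger HWx=\mu\,W^\dagger Wx$, that is, those with eigenvectors outside $\ker W$ (there is a system of $m$ generalized eigenvectors $x_i$ with $\langle x_i,W^2x_j\rangle=\delta_{ij}$). The spectral measure $|\alpha(E)|^2dE$ is the measure $I\mapsto\operatorname{Tr}[(VI)^2]=\sum_l\|P(I)v_l\|^2$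 on $\mathbb R$; it may have atoms. Put $$\lambda_{m^*}^\uparrow(V^2)(E)=\lambda_{m^*}\big((V(-\infty,E])^2\big),\qquad \lambda_{m^*}^\downarrow(V^2)(E)=\lambda_{m^*}\big((V[E,\infty))^2\big).$$ Suppose that $(H,V)$ is a signal to the interval $(E_a,E_b)$, that is, $$\int_{[E_b,\infty)}\frac{|\alpha(E)|^2}{\lambda_{m^*}^\uparrow(V^2)(E)}\,dE\le1\quad\text{and}\quad\int_{(-\infty,E_a]}\frac{|\alpha(E)|^2}{\lambda_{m^*}^\downarrow(V^2)(E)}\,dE\le1,$$ and let $B=V(E_a,E_b)$. Then for all $i\in\{1,\dots,\operatorname{rank}B^2\}$ the following integrals converge absolutely and $$\mu_i(V)-\mu_i(B)\le\int_{[E_b,\infty)}\frac{|\alpha(E)|^2}{\lambda_{m^*}^\uparrow(V^2)(E)}\,(E-\mu_i(B))\,dE,$$ $$\mu_i(V)-\mu_i(B)\ge\int_{(-\infty,E_a]}\frac{|\alpha(E)|^2}{\lambda_{m^*}^\downarrow(V^2)(E)}\,(E-\mu_i(B))\,dE.$$ -/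

import Mathlib

open MeasureTheory

/-- A projection-valued measure on the Borel sets of `ℝ`: orthogonal projections, multiplicative
on intersections, equal to the identity on `ℝ`, and strongly countably additive. -/
structure ProjectionValuedMeasure (𝕜 E : Type*) [RCLike 𝕜] [NormedAddCommGroup E]
    [InnerProductSpace 𝕜 E] [CompleteSpace E] where
  proj : Set ℝ → E →L[𝕜] E
  isStarProjection : ∀ s, MeasurableSet s → IsStarProjection (proj s)
  proj_univ : proj Set.univ = 1
  proj_inter : ∀ s t, MeasurableSet s → MeasurableSet t → proj (s ∩ t) = proj s * proj t
  hasSum_iUnion : ∀ f : ℕ → Set ℝ, (∀ n, MeasurableSet (f n)) →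
    Pairwise (Function.onFun Disjoint f) →
      ∀ x, HasSum (fun n => proj (f n) x) (proj (⋃ n, f n) x)

namespace ProjectionValuedMeasure

variable {𝕜 E : Type*} [RCLike 𝕜] [NormedAddCommGroup E] [InnerProductSpace 𝕜 E]
  [CompleteSpace E] (P : ProjectionValuedMeasure 𝕜 E)

theorem proj_empty : P.proj ∅ = 0 := by
  ext x
  have h := P.hasSum_iUnion (fun _ => ∅) (fun _ => MeasurableSet.empty)
    (fun _ _ _ => by simp [Function.onFun]) x
  exact (summable_const_iff _).1 h.summable

theorem re_inner_proj {s : Set ℝ} (hs : MeasurableSet s) (x : E) :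
    RCLike.re (inner 𝕜 x (P.proj s x)) = ‖P.proj s x‖ ^ 2 := by
  have h1 := (P.isStarProjection s hs).isIdempotentElem
  have h2 := (P.isStarProjection s hs).isSelfAdjoint
  have h3 : P.proj s x = P.proj s (P.proj s x) := by
    conv_lhs => rw [← h1.eq]
    rfl
  rw [h3, ← ContinuousLinearMap.adjoint_inner_left, ← ContinuousLinearMap.star_eq_adjoint,
    h2.star_eq, ← h3, inner_self_eq_norm_sq]

theorem hasSum_norm_sq {f : ℕ → Set ℝ} (hf : ∀ n, MeasurableSet (f n))
    (hd : Pairwise (Function.onFun Disjoint f)) (x : E) :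
    HasSum (fun n => ‖P.proj (f n) x‖ ^ 2) (‖P.proj (⋃ n, f n) x‖ ^ 2) := by
  have h := (P.hasSum_iUnion f hf hd x).mapL (innerSL 𝕜 x)
  have h' := h.mapL (RCLike.reCLM (K := 𝕜))
  rw [← P.re_inner_proj (MeasurableSet.iUnion hf)]
  simpa [← P.re_inner_proj (hf _)] using h'

/-- The scalar measure `s ↦ ⟨x, P(s) x⟩ = ‖P(s) x‖²` of a vector `x`. -/
noncomputable def scalarMeasure (x : E) : Measure ℝ :=
  Measure.ofMeasurable (fun s _ => ENNReal.ofReal (‖P.proj s x‖ ^ 2))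
    (by simp [P.proj_empty])
    (fun f hf hd => by
      have h := P.hasSum_norm_sq hf hd x
      rw [← h.tsum_eq, ENNReal.ofReal_tsum_of_nonneg (fun _ => by positivity) h.summable])

theorem scalarMeasure_apply {s : Set ℝ} (hs : MeasurableSet s) (x : E) :
    P.scalarMeasure x s = ENNReal.ofReal (‖P.proj s x‖ ^ 2) :=
  Measure.ofMeasurable_apply s hs

theorem scalarMeasure_proj {I : Set ℝ} (hI : MeasurableSet I) (x : E) :
    P.scalarMeasure (P.proj I x) = (P.scalarMeasure x).restrict I := by
  ext s hs
  rw [P.scalarMeasure_apply hs, Measure.restrict_apply hs, P.scalarMeasure_apply (hs.inter hI),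
    P.proj_inter s I hs hI]
  rfl

end ProjectionValuedMeasure

/-- The (possibly unbounded, everywhere or partially defined) operator `H` is Hermitian and has the
spectral resolution `P`, that is, `H = ∫ λ dP(λ)` with domain `{x | ∫ λ² d⟨x, P(λ) x⟩ < ∞}`.
Point and continuous spectrum may be mixed arbitrarily. -/
structure IsSpectralResolution {𝕜 E : Type*} [RCLike 𝕜] [NormedAddCommGroup E]
    [InnerProductSpace 𝕜 E] [CompleteSpace E] (H : E →ₗ.[𝕜] E)
    (P : ProjectionValuedMeasure 𝕜 E) : Prop where
  hermitian : H.IsFormalAdjoint H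
  mem_domain_iff : ∀ x : E, x ∈ H.domain ↔ Integrable (fun t : ℝ => t ^ 2) (P.scalarMeasure x)
  inner_apply : ∀ x : H.domain,
    inner 𝕜 (x : E) (H x) = ((∫ t, t ∂P.scalarMeasure (x : E) : ℝ) : 𝕜)

section GEP

variable {𝕜 E : Type*} [RCLike 𝕜] [NormedAddCommGroup E] [InnerProductSpace 𝕜 E]
  [CompleteSpace E] {M : ℕ}

theorem IsSpectralResolution.proj_mem_domain {H : E →ₗ.[𝕜] E} {P : ProjectionValuedMeasure 𝕜 E}
    (hP : IsSpectralResolution H P) {I : Set ℝ} (hI : MeasurableSet I) (x : H.domain) :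
    P.proj I (x : E) ∈ H.domain := by
  rw [hP.mem_domain_iff, P.scalarMeasure_proj hI]
  exact ((hP.mem_domain_iff _).1 x.2).restrict

/-- The projected guess vectors `V I = P(I) V`. -/
def projectedGuess {H : E →ₗ.[𝕜] E} {P : ProjectionValuedMeasure 𝕜 E}
    (hP : IsSpectralResolution H P) (v : Fin M → H.domain) (I : Set ℝ) (hI : MeasurableSet I) :
    Fin M → H.domain :=
  fun l => ⟨P.proj I (v l : E), hP.proj_mem_domain hI (v l)⟩

/-- The Gram matrix `V² = V† V`, with entries `⟨v_i, v_j⟩`. -/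
def gramMatrix {H : E →ₗ.[𝕜] E} (v : Fin M → H.domain) : Matrix (Fin M) (Fin M) 𝕜 :=
  Matrix.gram 𝕜 (fun l => (v l : E))

/-- The matrix `H_V = V† H V`, with entries `⟨v_i, H v_j⟩`. -/
def projectedMatrix (H : E →ₗ.[𝕜] E) (v : Fin M → H.domain) : Matrix (Fin M) (Fin M) 𝕜 :=
  Matrix.of fun i j => inner 𝕜 (v i : E) (H (v j))

/-- `μ 0 ≥ μ 1 ≥ ⋯ ≥ μ (m - 1)` are the proper eigenvalues, listed with multiplicity, of the
generalized eigenvalue problem `H_V x = μ V² x`, where `m = rank V²`: they belong to a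
`V²`-orthonormal system of `m` generalized eigenvectors. The remaining (spurious) values are set
to zero. -/
structure IsProperEigenvalues (H : E →ₗ.[𝕜] E) (v : Fin M → H.domain) (μ : ℕ → ℝ) : Prop where
  antitone : ∀ i j, i ≤ j → j < (gramMatrix v).rank → μ j ≤ μ i
  spurious : ∀ i, (gramMatrix v).rank ≤ i → μ i = 0
  exists_eigenvectors : ∃ x : Fin (gramMatrix v).rank → (Fin M → 𝕜),
    (∀ i j, star (x i) ⬝ᵥ (gramMatrix v).mulVec (x j) = if i = j then 1 else 0) ∧
    ∀ i, (projectedMatrix H v).mulVec (x i) = (μ i : 𝕜) • (gramMatrix v).mulVec (x i)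

/-- The smallest non-zero eigenvalue `λ_{m*}(V²)` of the Gram matrix. -/
noncomputable def minNonzeroEigenvalue {H : E →ₗ.[𝕜] E} (v : Fin M → H.domain) : ℝ :=
  sInf {r : ℝ | r ≠ 0 ∧ Module.End.HasEigenvalue (Matrix.toLin' (gramMatrix v)) (r : 𝕜)}

/-- The spectral measure `|α(E)|² dE`, that is, the measure
`I ↦ Tr ((V I)²) = ∑ l, ‖P(I) v_l‖²`. -/
noncomputable def spectralMeasure {H : E →ₗ.[𝕜] E} (P : ProjectionValuedMeasure 𝕜 E)
    (v : Fin M → H.domain) : Measure ℝ :=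
  ∑ l, P.scalarMeasure (v l : E)

/-- `λ_{m*}^↑(V²)(t)`, evaluated at the right-hand side of a discontinuity: the smallest non-zero
eigenvalue of the Gram matrix of `V (-∞, t]`. (At every `t` that is not an atom of the spectral
measure, `V (-∞, t] = V (-∞, t)`.) -/
noncomputable def lambdaUp {H : E →ₗ.[𝕜] E} {P : ProjectionValuedMeasure 𝕜 E}
    (hP : IsSpectralResolution H P) (v : Fin M → H.domain) (t : ℝ) : ℝ :=
  minNonzeroEigenvalue (projectedGuess hP v (Set.Iic t) measurableSet_Iic)

/-- `λ_{m*}^↓(V²)(t)`, evaluated at the left-hand side of a discontinuity: the smallest non-zero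
eigenvalue of the Gram matrix of `V [t, ∞)`. -/
noncomputable def lambdaDown {H : E →ₗ.[𝕜] E} {P : ProjectionValuedMeasure 𝕜 E}
    (hP : IsSpectralResolution H P) (v : Fin M → H.domain) (t : ℝ) : ℝ :=
  minNonzeroEigenvalue (projectedGuess hP v (Set.Ici t) measurableSet_Ici)

/-- The generalized eigenvalue problem is a signal to the energy interval `(Ea, Eb)`. -/
structure IsSignal {H : E →ₗ.[𝕜] E} {P : ProjectionValuedMeasure 𝕜 E}
    (hP : IsSpectralResolution H P) (v : Fin M → H.domain) (Ea Eb : ℝ) : Prop where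
  upper : ∫⁻ t in Set.Ici Eb, (ENNReal.ofReal (lambdaUp hP v t))⁻¹ ∂spectralMeasure P v ≤ 1
  lower : ∫⁻ t in Set.Iic Ea, (ENNReal.ofReal (lambdaDown hP v t))⁻¹ ∂spectralMeasure P v ≤ 1

end GEP

/-!
For a vector `x` in the span of the guess vectors put `m_x = ⟨x, P(·) x⟩`, so that
`⟨x, H x⟩ - c ‖x‖² = ∫ (t - c) dm_x`. Comparing dimensions as in the Courant–Fischer principle gives
such an `x ≠ 0` whose Rayleigh quotient is at least `μ_i(V)` while that of `P((E_a, E_b)) x` is at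
most `μ_i(B)`; subtracting, `(μ_i(V) - μ_i(B)) ‖x‖² ≤ ∫ (t - μ_i(B)) dm_x` over the complement of
`(E_a, E_b)`. A second `x` satisfies the reverse inequality.

It remains to bound `m_x` by `‖x‖² |α|² / λ_{m*}^↑`. The kernel of `V (-∞, t]` takes finitely many
values as `t` varies. As long as it is constant, the component in it of a coefficient vector of `x`
contributes nothing to `m_x`, and the remaining component `y` satisfies
`λ_{m*}^↑(t) ‖y‖² ≤ ‖V (-∞, t] y‖² ≤ ‖x‖²`, while `m_x ≤ ‖y‖² |α|²` by Cauchy–Schwarz. The bound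
with `λ_{m*}^↓` follows by the reflection `t ↦ -t`.
-/

section Gram

variable {𝕜 E ι : Type*} [RCLike 𝕜] [NormedAddCommGroup E] [InnerProductSpace 𝕜 E]

theorem gram_eq_zero_iff {w : ι → E} : Matrix.gram 𝕜 w = 0 ↔ w = 0 := by
  refine ⟨fun h => funext fun l => ?_, fun h => h ▸ Matrix.gram_zero⟩
  simpa [Matrix.gram_apply] using congrFun₂ h l l

variable [Fintype ι]

/-- The synthesis operator `x ↦ ∑ l, x l • w l` of a finite family of vectors, written `W` in the
paper; its Gram matrix represents `W† W`. -/
noncomputable def synthesis (w : ι → E) : EuclideanSpace 𝕜 ι →ₗ[𝕜] E :=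
  Fintype.linearCombination 𝕜 w ∘ₗ (WithLp.linearEquiv 2 𝕜 (ι → 𝕜)).toLinearMap

theorem synthesis_apply (w : ι → E) (x : EuclideanSpace 𝕜 ι) :
    synthesis w x = ∑ l, x l • w l := by
  simp [synthesis, Fintype.linearCombination_apply]

theorem norm_synthesis_sq_le (w : ι → E) (x : EuclideanSpace 𝕜 ι) :
    ‖synthesis w x‖ ^ 2 ≤ ‖x‖ ^ 2 * ∑ l, ‖w l‖ ^ 2 := by
  rw [synthesis_apply, EuclideanSpace.norm_sq_eq]
  calc ‖∑ l, x l • w l‖ ^ 2 ≤ (∑ l, ‖x l‖ * ‖w l‖) ^ 2 := by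
        gcongr
        exact (norm_sum_le _ _).trans_eq (by simp only [norm_smul])
    _ ≤ _ := Finset.sum_mul_sq_le_sq_mul_sq _ _ _

variable [DecidableEq ι]

/-- The smallest non-zero eigenvalue of a matrix, with value `0` if there is none. -/
noncomputable def smallestNonzeroEigenvalue (A : Matrix ι ι 𝕜) : ℝ :=
  sInf {r : ℝ | r ≠ 0 ∧ Module.End.HasEigenvalue (Matrix.toLin' A) (r : 𝕜)}

theorem hasEigenvalue_ofReal_iff {A : Matrix ι ι 𝕜} (hA : A.IsHermitian) (r : ℝ) :
    Module.End.HasEigenvalue (Matrix.toLin' A) (r : 𝕜) ↔ ∃ i, hA.eigenvalues i = r := by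
  rw [Module.End.hasEigenvalue_iff_mem_spectrum, Matrix.spectrum_toLin',
    hA.spectrum_eq_image_range]
  simp

theorem smallestNonzeroEigenvalue_zero : smallestNonzeroEigenvalue (0 : Matrix ι ι 𝕜) = 0 := by
  have hempty : {r : ℝ | r ≠ 0 ∧
      Module.End.HasEigenvalue (Matrix.toLin' (0 : Matrix ι ι 𝕜)) (r : 𝕜)} = ∅ := by
    refine Set.eq_empty_of_forall_notMem fun r ⟨hr, h⟩ => hr ?_
    obtain ⟨i, rfl⟩ := (hasEigenvalue_ofReal_iff Matrix.isHermitian_zero r).1 h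
    exact congrFun (Matrix.isHermitian_zero.eigenvalues_eq_zero_iff.2 rfl) i
  rw [smallestNonzeroEigenvalue, hempty, Real.sInf_empty]

theorem exists_eigenvalues_eq_smallestNonzeroEigenvalue {A : Matrix ι ι 𝕜} (hA : A.IsHermitian)
    (hA0 : A ≠ 0) :
    ∃ i, hA.eigenvalues i = smallestNonzeroEigenvalue A ∧ hA.eigenvalues i ≠ 0 := by
  obtain ⟨j, hj⟩ : ∃ j, hA.eigenvalues j ≠ 0 :=
    Function.ne_iff.1 (mt hA.eigenvalues_eq_zero_iff.1 hA0)
  have hfinite : {r : ℝ | r ≠ 0 ∧ Module.End.HasEigenvalue (Matrix.toLin' A) (r : 𝕜)}.Finite :=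
    (Set.finite_range hA.eigenvalues).subset fun r hr => (hasEigenvalue_ofReal_iff hA r).1 hr.2
  have hnonempty :
      {r : ℝ | r ≠ 0 ∧ Module.End.HasEigenvalue (Matrix.toLin' A) (r : 𝕜)}.Nonempty :=
    ⟨_, hj, (hasEigenvalue_ofReal_iff hA _).2 ⟨j, rfl⟩⟩
  obtain ⟨hne, heig⟩ := hnonempty.csInf_mem hfinite
  obtain ⟨i, hi⟩ := (hasEigenvalue_ofReal_iff hA _).1 heig
  exact ⟨i, hi, hi ▸ hne⟩

theorem inner_synthesis_eigenvectorBasis (w : ι → E) (i : ι) (x : EuclideanSpace 𝕜 ι) :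
    inner 𝕜 (synthesis w x)
        (synthesis w ((Matrix.isHermitian_gram 𝕜 w).eigenvectorBasis i)) =
      ((Matrix.isHermitian_gram 𝕜 w).eigenvalues i : 𝕜) *
        inner 𝕜 x ((Matrix.isHermitian_gram 𝕜 w).eigenvectorBasis i) := by
  rw [synthesis_apply, synthesis_apply, ← Matrix.star_dotProduct_gram_mulVec,
    Matrix.IsHermitian.mulVec_eigenvectorBasis, dotProduct_smul,
    EuclideanSpace.inner_eq_star_dotProduct, dotProduct_comm, RCLike.real_smul_eq_coe_mul]

theorem norm_synthesis_sq (w : ι → E) (x : EuclideanSpace 𝕜 ι) :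
    ‖synthesis w x‖ ^ 2 = ∑ i, (Matrix.isHermitian_gram 𝕜 w).eigenvalues i *
      ‖inner 𝕜 ((Matrix.isHermitian_gram 𝕜 w).eigenvectorBasis i) x‖ ^ 2 := by
  set b := (Matrix.isHermitian_gram 𝕜 w).eigenvectorBasis
  have h : inner 𝕜 (synthesis w x) (synthesis w x) =
      ((∑ i, (Matrix.isHermitian_gram 𝕜 w).eigenvalues i * ‖inner 𝕜 (b i) x‖ ^ 2 : ℝ) : 𝕜) := by
    conv_lhs => enter [3]; rw [← b.sum_repr' x]
    simp only [map_sum, map_smul, inner_sum, inner_smul_right]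
    push_cast
    refine Finset.sum_congr rfl fun i _ => ?_
    rw [inner_synthesis_eigenvectorBasis, mul_left_comm, ← inner_conj_symm x, RCLike.mul_conj]
  rw [inner_self_eq_norm_sq_to_K] at h
  exact_mod_cast h

theorem norm_synthesis_eigenvectorBasis_sq (w : ι → E) (i : ι) :
    ‖synthesis w ((Matrix.isHermitian_gram 𝕜 w).eigenvectorBasis i)‖ ^ 2 =
      (Matrix.isHermitian_gram 𝕜 w).eigenvalues i := by
  simp [norm_synthesis_sq, OrthonormalBasis.inner_eq_ite, apply_ite]

theorem nonneg_of_hasEigenvalue_gram {w : ι → E} {r : ℝ}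
    (h : Module.End.HasEigenvalue (Matrix.toLin' (Matrix.gram 𝕜 w)) (r : 𝕜)) : 0 ≤ r := by
  obtain ⟨i, rfl⟩ := (hasEigenvalue_ofReal_iff (Matrix.isHermitian_gram 𝕜 w) r).1 h
  exact (Matrix.posSemidef_gram 𝕜 w).eigenvalues_nonneg i

theorem smallestNonzeroEigenvalue_gram_nonneg (w : ι → E) :
    0 ≤ smallestNonzeroEigenvalue (Matrix.gram 𝕜 w) :=
  Real.sInf_nonneg fun _ hr => nonneg_of_hasEigenvalue_gram hr.2

theorem smallestNonzeroEigenvalue_gram_pos {w : ι → E} (hw : w ≠ 0) :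
    0 < smallestNonzeroEigenvalue (Matrix.gram 𝕜 w) := by
  obtain ⟨i, hi, hne⟩ := exists_eigenvalues_eq_smallestNonzeroEigenvalue
    (Matrix.isHermitian_gram 𝕜 w) (mt gram_eq_zero_iff.1 hw)
  exact (smallestNonzeroEigenvalue_gram_nonneg w).lt_of_ne (hi ▸ hne.symm)

theorem smallestNonzeroEigenvalue_gram_le {w : ι → E} {i : ι}
    (hi : (Matrix.isHermitian_gram 𝕜 w).eigenvalues i ≠ 0) :
    smallestNonzeroEigenvalue (Matrix.gram 𝕜 w) ≤ (Matrix.isHermitian_gram 𝕜 w).eigenvalues i :=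
  csInf_le ⟨0, fun _ hr => nonneg_of_hasEigenvalue_gram hr.2⟩
    ⟨hi, (hasEigenvalue_ofReal_iff (Matrix.isHermitian_gram 𝕜 w) _).2 ⟨i, rfl⟩⟩

theorem smallestNonzeroEigenvalue_gram_mul_le (w : ι → E) {x : EuclideanSpace 𝕜 ι}
    (hx : x ∈ (LinearMap.ker (synthesis (𝕜 := 𝕜) w))ᗮ) :
    smallestNonzeroEigenvalue (Matrix.gram 𝕜 w) * ‖x‖ ^ 2 ≤ ‖synthesis w x‖ ^ 2 := by
  rw [norm_synthesis_sq, ← (Matrix.isHermitian_gram 𝕜 w).eigenvectorBasis.sum_sq_norm_inner_right x,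
    Finset.mul_sum]
  refine Finset.sum_le_sum fun i _ => ?_
  by_cases hi : (Matrix.isHermitian_gram 𝕜 w).eigenvalues i = 0
  · have hker := norm_synthesis_eigenvectorBasis_sq (𝕜 := 𝕜) w i
    rw [hi, sq_eq_zero_iff, norm_eq_zero] at hker
    simp [Submodule.inner_right_of_mem_orthogonal (LinearMap.mem_ker.2 hker) hx]
  · gcongr
    exact smallestNonzeroEigenvalue_gram_le hi

theorem exists_norm_synthesis_sq_eq {w : ι → E} (hw : w ≠ 0) :
    ∃ x ∈ (LinearMap.ker (synthesis (𝕜 := 𝕜) w))ᗮ, ‖x‖ = 1 ∧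
      ‖synthesis w x‖ ^ 2 = smallestNonzeroEigenvalue (Matrix.gram 𝕜 w) := by
  have hA := Matrix.isHermitian_gram 𝕜 w
  obtain ⟨i, hi, hne⟩ := exists_eigenvalues_eq_smallestNonzeroEigenvalue hA
    (mt gram_eq_zero_iff.1 hw)
  refine ⟨hA.eigenvectorBasis i, (Submodule.mem_orthogonal _ _).2 fun z hz => ?_, by simp,
    (norm_synthesis_eigenvectorBasis_sq w i).trans hi⟩
  have h := inner_synthesis_eigenvectorBasis w i z
  rw [LinearMap.mem_ker.1 hz, inner_zero_left] at h
  exact (mul_eq_zero.1 h.symm).resolve_left (RCLike.ofReal_ne_zero.2 hne)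

theorem norm_sq_le_inv_smallestNonzeroEigenvalue_gram_mul (w : ι → E) {x : EuclideanSpace 𝕜 ι}
    (hx : x ∈ (LinearMap.ker (synthesis (𝕜 := 𝕜) w))ᗮ) :
    ‖x‖ ^ 2 ≤ (smallestNonzeroEigenvalue (Matrix.gram 𝕜 w))⁻¹ * ‖synthesis w x‖ ^ 2 := by
  rcases eq_or_ne w 0 with rfl | hw
  · have hker : LinearMap.ker (synthesis (𝕜 := 𝕜) (0 : ι → E)) = ⊤ :=
      LinearMap.ker_eq_top.2 (LinearMap.ext fun z => by simp [synthesis_apply])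
    rw [hker, Submodule.top_orthogonal_eq_bot, Submodule.mem_bot] at hx
    simp [hx]
  · exact (le_inv_mul_iff₀ (smallestNonzeroEigenvalue_gram_pos hw)).2
      (smallestNonzeroEigenvalue_gram_mul_le w hx)

theorem inv_smallestNonzeroEigenvalue_gram_le {w w' : ι → E}
    (hker : LinearMap.ker (synthesis (𝕜 := 𝕜) w) ≤ LinearMap.ker (synthesis (𝕜 := 𝕜) w'))
    (hle : ∀ x : EuclideanSpace 𝕜 ι, ‖synthesis w x‖ ≤ ‖synthesis w' x‖) :
    (smallestNonzeroEigenvalue (Matrix.gram 𝕜 w'))⁻¹ ≤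
      (smallestNonzeroEigenvalue (Matrix.gram 𝕜 w))⁻¹ := by
  have hnonneg := inv_nonneg.2 (smallestNonzeroEigenvalue_gram_nonneg (𝕜 := 𝕜) w)
  rcases eq_or_ne w' 0 with rfl | hw'
  · rwa [Matrix.gram_zero, smallestNonzeroEigenvalue_zero, inv_zero]
  · obtain ⟨x, hx, hx1, hmin⟩ := exists_norm_synthesis_sq_eq (𝕜 := 𝕜) hw'
    rw [inv_le_iff_one_le_mul₀ (smallestNonzeroEigenvalue_gram_pos hw'), ← hmin]
    calc (1 : ℝ) = ‖x‖ ^ 2 := by rw [hx1, one_pow]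
      _ ≤ (smallestNonzeroEigenvalue (Matrix.gram 𝕜 w))⁻¹ * ‖synthesis w x‖ ^ 2 :=
        norm_sq_le_inv_smallestNonzeroEigenvalue_gram_mul w (Submodule.orthogonal_le hker hx)
      _ ≤ (smallestNonzeroEigenvalue (Matrix.gram 𝕜 w))⁻¹ * ‖synthesis w' x‖ ^ 2 := by
        gcongr
        exact hle x

end Gram

section Measure

theorem measure_eq_zero_of_forall_measure_Iic_eq_zero {α : Type*} [TopologicalSpace α]
    [LinearOrder α] [ClosedIciTopology α] [SecondCountableTopology α] [MeasurableSpace α]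
    {m : Measure α} {s : Set α} (h : ∀ t ∈ s, m (Set.Iic t) = 0) : m s = 0 := by
  refine measure_null_of_locally_null s fun x hx => ?_
  by_cases hmax : ∃ t ∈ s, x < t
  · obtain ⟨t, ht, hxt⟩ := hmax
    exact ⟨Set.Iio t, mem_nhdsWithin_of_mem_nhds (Iio_mem_nhds hxt),
      measure_mono_null Set.Iio_subset_Iic_self (h t ht)⟩
  · push Not at hmax
    exact ⟨Set.Iic x, Filter.mem_of_superset self_mem_nhdsWithin hmax, h x hx⟩

theorem iUnion_preimage_singleton_eq_univ {α κ : Type*} (f : α → κ) :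
    ⋃ k, f ⁻¹' {k} = Set.univ :=
  Set.iUnion_eq_univ_iff.2 fun a => ⟨f a, rfl⟩

theorem measure_le_of_forall_restrict_fiber_le {α κ : Type*} [MeasurableSpace α]
    [MeasurableSpace κ] [MeasurableSingletonClass κ] [Countable κ] {m m' : Measure α} {f : α → κ}
    (hf : Measurable f) (h : ∀ k, m.restrict (f ⁻¹' {k}) ≤ m'.restrict (f ⁻¹' {k})) : m ≤ m' := by
  refine Measure.le_iff.2 fun A hA => ?_
  rw [← m.restrict_univ, ← m'.restrict_univ, ← iUnion_preimage_singleton_eq_univ f,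
    Measure.restrict_iUnion (pairwise_disjoint_fiber f) fun k => hf (measurableSet_singleton k),
    Measure.restrict_iUnion (pairwise_disjoint_fiber f) fun k => hf (measurableSet_singleton k),
    Measure.sum_apply _ hA, Measure.sum_apply _ hA]
  exact ENNReal.tsum_le_tsum fun k => h k A

theorem setIntegral_le_of_le_smul_withDensity {α : Type*} [MeasurableSpace α] {m ν : Measure α}
    {f g : α → ℝ} {C : ℝ} {s : Set α} (hs : MeasurableSet s) (hC : 0 ≤ C)
    (hg : AEMeasurable g ν) (hg0 : ∀ t, 0 ≤ g t)
    (hm : m ≤ ENNReal.ofReal C • ν.withDensity fun t => ENNReal.ofReal (g t))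
    (hf : ∀ t ∈ s, 0 ≤ f t) (hfg : IntegrableOn (fun t => g t * f t) s ν) :
    ∫ t in s, f t ∂m ≤ C * ∫ t in s, g t * f t ∂ν := by
  have hgs : AEMeasurable (fun t => ENNReal.ofReal (g t)) (ν.restrict s) :=
    hg.ennreal_ofReal.restrict
  have hfin : ∀ᵐ t ∂ν.restrict s, ENNReal.ofReal (g t) < ⊤ :=
    ae_of_all _ fun _ => ENNReal.ofReal_lt_top
  have hden : (ν.withDensity fun t => ENNReal.ofReal (g t)).restrict s =
      (ν.restrict s).withDensity fun t => ENNReal.ofReal (g t) := restrict_withDensity hs _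
  calc ∫ t in s, f t ∂m
      ≤ ∫ t in s, f t ∂(ENNReal.ofReal C • ν.withDensity fun t => ENNReal.ofReal (g t)) := by
        refine integral_mono_measure (Measure.restrict_mono le_rfl hm)
          ((ae_restrict_iff' hs).2 (ae_of_all _ hf)) ?_
        rw [Measure.restrict_smul]
        refine Integrable.smul_measure ?_ ENNReal.ofReal_ne_top
        rw [hden, integrable_withDensity_iff_integrable_smul₀' hgs hfin]
        simpa only [ENNReal.toReal_ofReal (hg0 _), smul_eq_mul, IntegrableOn] using hfg
    _ = C * ∫ t in s, g t * f t ∂ν := by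
        rw [Measure.restrict_smul, integral_smul_measure, ENNReal.toReal_ofReal hC, smul_eq_mul,
          hden, integral_withDensity_eq_integral_toReal_smul₀ hgs hfin]
        simp only [ENNReal.toReal_ofReal (hg0 _), smul_eq_mul]

theorem setIntegral_pos {α : Type*} [MeasurableSpace α] {m : Measure α} {f : α → ℝ} {s : Set α}
    (hs : MeasurableSet s) (hms : m s ≠ 0) (hf : ∀ t ∈ s, 0 < f t) (hfm : IntegrableOn f s m) :
    0 < ∫ t in s, f t ∂m := by
  have hsupport : s ⊆ Function.support f := fun t ht => (hf t ht).ne'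
  rw [setIntegral_pos_iff_support_of_nonneg_ae
    ((ae_restrict_iff' hs).2 (ae_of_all _ fun t ht => (hf t ht).le)) hfm,
    Set.inter_eq_right.2 hsupport]
  exact hms.bot_lt

theorem setIntegral_compl_Ioo {α F : Type*} [LinearOrder α] [TopologicalSpace α]
    [OrderClosedTopology α] [MeasurableSpace α] [OpensMeasurableSpace α] [NormedAddCommGroup F]
    [NormedSpace ℝ F] {m : Measure α} {f : α → F} (hf : Integrable f m) {a b : α} (hab : a < b) :
    ∫ t in (Set.Ioo a b)ᶜ, f t ∂m = ∫ t in Set.Iic a, f t ∂m + ∫ t in Set.Ici b, f t ∂m := by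
  rw [← Set.Ioi_inter_Iio, Set.compl_inter, Set.compl_Ioi, Set.compl_Iio]
  exact setIntegral_union (Set.Iic_disjoint_Ici.2 hab.not_ge) measurableSet_Ici
    hf.integrableOn hf.integrableOn

theorem integrable_inv_of_lintegral_inv_ofReal_ne_top {α : Type*} [MeasurableSpace α]
    {m : Measure α} {g : α → ℝ} (hg : AEMeasurable (fun t => (g t)⁻¹) m)
    (h : ∫⁻ t, (ENNReal.ofReal (g t))⁻¹ ∂m ≠ ⊤) : Integrable (fun t => (g t)⁻¹) m := by
  refine ⟨hg.aestronglyMeasurable, lt_of_le_of_lt (lintegral_mono fun t => ?_) h.lt_top⟩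
  rcases le_or_gt (g t) 0 with hnonpos | hpos
  · simp [ENNReal.ofReal_of_nonpos hnonpos]
  · rw [Real.enorm_of_nonneg (inv_nonneg.2 hpos.le), ENNReal.ofReal_inv_of_pos hpos]

section Neg

variable {G F : Type*} [AddCommGroup G] [MeasurableSpace G] [MeasurableNeg G]
  [NormedAddCommGroup F] {m : Measure G}

theorem integrable_neg_measure {f : G → F} :
    Integrable f m.neg ↔ Integrable (fun t => f (-t)) m :=
  integrable_map_equiv (MeasurableEquiv.neg G) f

variable [PartialOrder G] [IsOrderedAddMonoid G]

theorem integrableOn_Ici_neg_measure {f : G → F} {a : G} :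
    IntegrableOn f (Set.Ici (-a)) m.neg ↔ IntegrableOn (fun t => f (-t)) (Set.Iic a) m := by
  rw [show m.neg = m.map (MeasurableEquiv.neg G) from rfl, integrableOn_map_equiv]
  simp [Function.comp_def, Set.neg_preimage]

theorem setIntegral_Ici_neg_measure [NormedSpace ℝ F] (f : G → F) (a : G) :
    ∫ t in Set.Ici (-a), f t ∂m.neg = ∫ t in Set.Iic a, f (-t) ∂m := by
  rw [show m.neg = m.map (MeasurableEquiv.neg G) from rfl, setIntegral_map_equiv]
  simp [Set.neg_preimage]

end Neg

end Measure

namespace ProjectionValuedMeasure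

section Basic

variable {𝕜 E ι : Type*} [RCLike 𝕜] [NormedAddCommGroup E] [InnerProductSpace 𝕜 E]
  [CompleteSpace E] (P : ProjectionValuedMeasure 𝕜 E)

instance isFiniteMeasure_scalarMeasure (x : E) : IsFiniteMeasure (P.scalarMeasure x) :=
  ⟨by rw [P.scalarMeasure_apply MeasurableSet.univ]; exact ENNReal.ofReal_lt_top⟩

theorem scalarMeasure_real {s : Set ℝ} (hs : MeasurableSet s) (x : E) :
    (P.scalarMeasure x).real s = ‖P.proj s x‖ ^ 2 := by
  rw [measureReal_def, P.scalarMeasure_apply hs, ENNReal.toReal_ofReal (by positivity)]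

theorem scalarMeasure_real_univ (x : E) : (P.scalarMeasure x).real Set.univ = ‖x‖ ^ 2 := by
  rw [P.scalarMeasure_real MeasurableSet.univ, P.proj_univ, one_apply_eq_self]

theorem scalarMeasure_eq_zero_iff {s : Set ℝ} (hs : MeasurableSet s) (x : E) :
    P.scalarMeasure x s = 0 ↔ P.proj s x = 0 := by
  rw [← measureReal_eq_zero_iff, P.scalarMeasure_real hs, sq_eq_zero_iff, norm_eq_zero]

theorem norm_proj_le_of_subset {s t : Set ℝ} (hs : MeasurableSet s) (ht : MeasurableSet t)
    (hst : s ⊆ t) (x : E) : ‖P.proj s x‖ ≤ ‖P.proj t x‖ := by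
  refine (pow_le_pow_iff_left₀ (norm_nonneg _) (norm_nonneg _) two_ne_zero).1 ?_
  rw [← P.scalarMeasure_real hs, ← P.scalarMeasure_real ht]
  exact measureReal_mono hst

theorem norm_proj_le {s : Set ℝ} (hs : MeasurableSet s) (x : E) : ‖P.proj s x‖ ≤ ‖x‖ := by
  simpa [P.proj_univ] using P.norm_proj_le_of_subset hs MeasurableSet.univ s.subset_univ x

variable [Fintype ι]

theorem synthesis_proj (v : ι → E) (s : Set ℝ) (x : EuclideanSpace 𝕜 ι) :
    synthesis (fun l => P.proj s (v l)) x = P.proj s (synthesis v x) := by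
  simp only [synthesis_apply, map_sum, map_smul]

/-- The measure `s ↦ ∑ l, ‖P(s) v_l‖²` of a finite family of vectors, written `|α(E)|² dE` in the
paper. -/
noncomputable def traceMeasure (v : ι → E) : Measure ℝ :=
  ∑ l, P.scalarMeasure (v l)

theorem traceMeasure_apply {s : Set ℝ} (hs : MeasurableSet s) (v : ι → E) :
    P.traceMeasure v s = ENNReal.ofReal (∑ l, ‖P.proj s (v l)‖ ^ 2) := by
  rw [traceMeasure, Measure.finsetSum_apply, ENNReal.ofReal_sum_of_nonneg
    fun _ _ => by positivity]
  simp only [P.scalarMeasure_apply hs]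

theorem scalarMeasure_synthesis_le (v : ι → E) (x : EuclideanSpace 𝕜 ι) :
    P.scalarMeasure (synthesis v x) ≤ ENNReal.ofReal (‖x‖ ^ 2) • P.traceMeasure v := by
  refine Measure.le_iff.2 fun s hs => ?_
  rw [Measure.smul_apply, smul_eq_mul, P.scalarMeasure_apply hs, P.traceMeasure_apply hs,
    ← ENNReal.ofReal_mul (by positivity), ← P.synthesis_proj]
  exact ENNReal.ofReal_le_ofReal (norm_synthesis_sq_le _ x)

end Basic

section LowKernel

variable {𝕜 E ι : Type*} [RCLike 𝕜] [NormedAddCommGroup E] [InnerProductSpace 𝕜 E]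
  [CompleteSpace E] [Fintype ι] (P : ProjectionValuedMeasure 𝕜 E) (v : ι → E)

/-- The kernel of the synthesis operator of the family `P((-∞, t]) v`. It shrinks as `t` grows and,
living in a finite-dimensional space, takes only finitely many values; `1 / λ_{m*}^↑` is monotone
as long as it stays constant. -/
noncomputable def lowKernel (t : ℝ) : Submodule 𝕜 (EuclideanSpace 𝕜 ι) :=
  LinearMap.ker (synthesis fun l => P.proj (Set.Iic t) (v l))

theorem mem_lowKernel {t : ℝ} {x : EuclideanSpace 𝕜 ι} :
    x ∈ P.lowKernel v t ↔ P.proj (Set.Iic t) (synthesis v x) = 0 := by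
  rw [lowKernel, LinearMap.mem_ker, synthesis_proj]

theorem lowKernel_antitone : Antitone (P.lowKernel v) := by
  intro s t hst x hx
  rw [mem_lowKernel] at hx ⊢
  rw [← norm_le_zero_iff, ← norm_zero (E := E), ← hx]
  exact P.norm_proj_le_of_subset measurableSet_Iic measurableSet_Iic (Set.Iic_subset_Iic.2 hst) _

theorem measurable_finrank_lowKernel :
    Measurable fun t => Module.finrank 𝕜 (P.lowKernel v t) :=
  Antitone.measurable fun _ _ hst => Submodule.finrank_mono (P.lowKernel_antitone v hst)

theorem lowKernel_eq_of_finrank_eq {s t : ℝ}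
    (h : Module.finrank 𝕜 (P.lowKernel v s) = Module.finrank 𝕜 (P.lowKernel v t)) :
    P.lowKernel v s = P.lowKernel v t := by
  rcases le_total s t with hst | hst
  · exact (Submodule.eq_of_le_of_finrank_eq (P.lowKernel_antitone v hst) h.symm).symm
  · exact Submodule.eq_of_le_of_finrank_eq (P.lowKernel_antitone v hst) h

theorem exists_forall_ge_lowKernel_eq :
    ∃ T, ∀ t, T ≤ t → P.lowKernel v t = P.lowKernel v T := by
  obtain ⟨_, ⟨T, rfl⟩, hmin⟩ := wellFounded_lt.has_min (Set.range (P.lowKernel v))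
    (Set.range_nonempty _)
  exact ⟨T, fun t ht => (P.lowKernel_antitone v ht).eq_of_not_lt (hmin _ ⟨t, rfl⟩)⟩

theorem proj_synthesis_eq_zero_of_mem_lowKernel {s : Set ℝ} (hs : MeasurableSet s)
    {x : EuclideanSpace 𝕜 ι} (hx : ∀ t ∈ s, x ∈ P.lowKernel v t) :
    P.proj s (synthesis v x) = 0 := by
  rw [← P.scalarMeasure_eq_zero_iff hs]
  refine measure_eq_zero_of_forall_measure_Iic_eq_zero fun t ht => ?_
  rw [P.scalarMeasure_eq_zero_iff measurableSet_Iic, ← mem_lowKernel]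
  exact hx t ht

end LowKernel

section GramGap

variable {𝕜 E ι : Type*} [RCLike 𝕜] [NormedAddCommGroup E] [InnerProductSpace 𝕜 E]
  [CompleteSpace E] [Fintype ι] [DecidableEq ι] (P : ProjectionValuedMeasure 𝕜 E) (v : ι → E)

/-- The smallest non-zero eigenvalue of the Gram matrix of the projected family `P(s) v`, so that
`λ_{m*}^↑` and `λ_{m*}^↓` are its values at `(-∞, t]` and `[t, ∞)`. -/
noncomputable def gramGap (s : Set ℝ) : ℝ :=
  smallestNonzeroEigenvalue (Matrix.gram 𝕜 fun l => P.proj s (v l))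

theorem gramGap_nonneg (s : Set ℝ) : 0 ≤ P.gramGap v s :=
  smallestNonzeroEigenvalue_gram_nonneg _

theorem norm_sq_le_mul_inv_gramGap_Iic {t : ℝ} {x : EuclideanSpace 𝕜 ι}
    (hx : x ∈ (P.lowKernel v t)ᗮ) :
    ‖x‖ ^ 2 ≤ ‖P.proj (Set.Iic t) (synthesis v x)‖ ^ 2 * (P.gramGap v (Set.Iic t))⁻¹ := by
  rw [← P.synthesis_proj, mul_comm]
  exact norm_sq_le_inv_smallestNonzeroEigenvalue_gram_mul _ hx

theorem inv_gramGap_Iic_le {s t : ℝ} (hst : s ≤ t) (hker : P.lowKernel v s = P.lowKernel v t) :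
    (P.gramGap v (Set.Iic t))⁻¹ ≤ (P.gramGap v (Set.Iic s))⁻¹ := by
  refine inv_smallestNonzeroEigenvalue_gram_le hker.le fun x => ?_
  rw [P.synthesis_proj, P.synthesis_proj]
  exact P.norm_proj_le_of_subset measurableSet_Iic measurableSet_Iic (Set.Iic_subset_Iic.2 hst) _

theorem aemeasurable_inv_gramGap_Iic (m : Measure ℝ) :
    AEMeasurable (fun t => (P.gramGap v (Set.Iic t))⁻¹) m := by
  rw [← m.restrict_univ,
    ← iUnion_preimage_singleton_eq_univ fun t => Module.finrank 𝕜 (P.lowKernel v t),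
    aemeasurable_iUnion_iff]
  refine fun k => aemeasurable_restrict_of_antitoneOn
    (P.measurable_finrank_lowKernel v (measurableSet_singleton k)) fun s hs t ht hst => ?_
  exact P.inv_gramGap_Iic_le v hst (P.lowKernel_eq_of_finrank_eq v (hs.trans ht.symm))

theorem exists_restrict_scalarMeasure_synthesis_eq {s : Set ℝ} (hs : MeasurableSet s)
    {K : Submodule 𝕜 (EuclideanSpace 𝕜 ι)} (hK : ∀ t ∈ s, P.lowKernel v t = K)
    (x : EuclideanSpace 𝕜 ι) :
    ∃ y : EuclideanSpace 𝕜 ι,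
      (P.scalarMeasure (synthesis v x)).restrict s = (P.scalarMeasure (synthesis v y)).restrict s ∧
      ∀ t ∈ s, ‖y‖ ^ 2 ≤ ‖synthesis v x‖ ^ 2 * (P.gramGap v (Set.Iic t))⁻¹ := by
  set y := x - K.starProjection x
  have hyK : y ∈ Kᗮ := K.sub_starProjection_mem_orthogonal x
  have hxy : x - y ∈ K := by
    rw [sub_sub_cancel]
    exact K.starProjection_apply_mem x
  have hproj : ∀ {t : Set ℝ}, P.proj t (synthesis v (x - y)) = 0 →
      P.proj t (synthesis v x) = P.proj t (synthesis v y) := fun h => by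
    rwa [map_sub, map_sub, sub_eq_zero] at h
  refine ⟨y, ?_, fun t ht => ?_⟩
  · rw [← P.scalarMeasure_proj hs, ← P.scalarMeasure_proj hs, hproj
      (P.proj_synthesis_eq_zero_of_mem_lowKernel v hs fun t ht => (hK t ht).symm ▸ hxy)]
  · rw [← hK t ht] at hyK hxy
    refine (P.norm_sq_le_mul_inv_gramGap_Iic v hyK).trans ?_
    rw [← hproj ((P.mem_lowKernel v).1 hxy)]
    have := inv_nonneg.2 (P.gramGap_nonneg v (Set.Iic t))
    gcongr
    exact P.norm_proj_le measurableSet_Iic _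

theorem restrict_scalarMeasure_synthesis_le {s : Set ℝ} (hs : MeasurableSet s)
    {K : Submodule 𝕜 (EuclideanSpace 𝕜 ι)} (hK : ∀ t ∈ s, P.lowKernel v t = K)
    (x : EuclideanSpace 𝕜 ι) :
    (P.scalarMeasure (synthesis v x)).restrict s ≤ (ENNReal.ofReal (‖synthesis v x‖ ^ 2) •
      (P.traceMeasure v).withDensity
        fun t => ENNReal.ofReal (P.gramGap v (Set.Iic t))⁻¹).restrict s := by
  obtain ⟨y, hxy, hnorm⟩ := P.exists_restrict_scalarMeasure_synthesis_eq v hs hK x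
  calc (P.scalarMeasure (synthesis v x)).restrict s
      = (P.scalarMeasure (synthesis v y)).restrict s := hxy
    _ ≤ (ENNReal.ofReal (‖y‖ ^ 2) • P.traceMeasure v).restrict s :=
        Measure.restrict_mono le_rfl (P.scalarMeasure_synthesis_le v y)
    _ = ((P.traceMeasure v).restrict s).withDensity fun _ => ENNReal.ofReal (‖y‖ ^ 2) := by
        rw [withDensity_const, Measure.restrict_smul]
    _ ≤ ((P.traceMeasure v).restrict s).withDensity
          (ENNReal.ofReal (‖synthesis v x‖ ^ 2) •
            fun t => ENNReal.ofReal (P.gramGap v (Set.Iic t))⁻¹) := by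
        refine withDensity_mono ((ae_restrict_iff' hs).2 (ae_of_all _ fun t ht => ?_))
        rw [Pi.smul_apply, smul_eq_mul, ← ENNReal.ofReal_mul (by positivity)]
        exact ENNReal.ofReal_le_ofReal (hnorm t ht)
    _ = _ := by
        rw [Measure.restrict_smul, restrict_withDensity hs,
          withDensity_smul' _ _ ENNReal.ofReal_ne_top]

theorem scalarMeasure_synthesis_le_withDensity (x : EuclideanSpace 𝕜 ι) :
    P.scalarMeasure (synthesis v x) ≤ ENNReal.ofReal (‖synthesis v x‖ ^ 2) •
      (P.traceMeasure v).withDensity fun t => ENNReal.ofReal (P.gramGap v (Set.Iic t))⁻¹ := by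
  refine measure_le_of_forall_restrict_fiber_le (P.measurable_finrank_lowKernel v) fun k => ?_
  rcases Set.eq_empty_or_nonempty
    ((fun t => Module.finrank 𝕜 (P.lowKernel v t)) ⁻¹' {k}) with hempty | ⟨t₀, ht₀⟩
  · simp only [hempty, Measure.restrict_empty, le_refl]
  · exact P.restrict_scalarMeasure_synthesis_le v
      (P.measurable_finrank_lowKernel v (measurableSet_singleton k))
      (fun t ht => P.lowKernel_eq_of_finrank_eq v (ht.trans ht₀.symm)) x

end GramGap

section TailIntegral

variable {𝕜 E ι : Type*} [RCLike 𝕜] [NormedAddCommGroup E] [InnerProductSpace 𝕜 E]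
  [CompleteSpace E] [Fintype ι] [DecidableEq ι] (P : ProjectionValuedMeasure 𝕜 E) (v : ι → E)

theorem integrableOn_Ici_div_gramGap {f : ℝ → ℝ} (hf : Continuous f)
    (hfν : Integrable f (P.traceMeasure v)) {b : ℝ}
    (h : IntegrableOn (fun t => (P.gramGap v (Set.Iic t))⁻¹) (Set.Ici b) (P.traceMeasure v)) :
    IntegrableOn (fun t => f t / P.gramGap v (Set.Iic t)) (Set.Ici b) (P.traceMeasure v) := by
  obtain ⟨T, hT⟩ := P.exists_forall_ge_lowKernel_eq v
  have hcompact : IntegrableOn (fun t => f t / P.gramGap v (Set.Iic t)) (Set.Icc b T)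
      (P.traceMeasure v) := by
    simpa only [div_eq_mul_inv] using
      (h.mono_set Set.Icc_subset_Ici_self).continuousOn_mul hf.continuousOn isCompact_Icc
  have htail : IntegrableOn (fun t => f t / P.gramGap v (Set.Iic t)) (Set.Ici T)
      (P.traceMeasure v) := by
    simp only [div_eq_mul_inv]
    refine hfν.integrableOn.mul_bdd (c := (P.gramGap v (Set.Iic T))⁻¹)
      (P.aemeasurable_inv_gramGap_Iic v _).aestronglyMeasurable
      ((ae_restrict_iff' measurableSet_Ici).2 (ae_of_all _ fun t ht => ?_))
    rw [Real.norm_of_nonneg (inv_nonneg.2 (P.gramGap_nonneg v _))]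
    exact P.inv_gramGap_Iic_le v ht (hT t ht).symm
  refine (hcompact.union htail).mono_set fun t ht => ?_
  exact (le_total t T).imp (fun htT => ⟨ht, htT⟩) id

theorem setIntegral_Ici_scalarMeasure_synthesis_le {f : ℝ → ℝ} {b : ℝ}
    (hf : ∀ t ∈ Set.Ici b, 0 ≤ f t)
    (h : IntegrableOn (fun t => f t / P.gramGap v (Set.Iic t)) (Set.Ici b) (P.traceMeasure v))
    (x : EuclideanSpace 𝕜 ι) :
    ∫ t in Set.Ici b, f t ∂P.scalarMeasure (synthesis v x) ≤
      ‖synthesis v x‖ ^ 2 *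
        ∫ t in Set.Ici b, f t / P.gramGap v (Set.Iic t) ∂P.traceMeasure v := by
  simp only [div_eq_inv_mul] at h ⊢
  exact setIntegral_le_of_le_smul_withDensity measurableSet_Ici (by positivity)
    (P.aemeasurable_inv_gramGap_Iic v _) (fun t => inv_nonneg.2 (P.gramGap_nonneg v _))
    (P.scalarMeasure_synthesis_le_withDensity v x) hf h

end TailIntegral

section Reflect

variable {𝕜 E ι : Type*} [RCLike 𝕜] [NormedAddCommGroup E] [InnerProductSpace 𝕜 E]
  [CompleteSpace E] (P : ProjectionValuedMeasure 𝕜 E)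

/-- The image of a projection-valued measure under `t ↦ -t`; it turns statements about `(-∞, t]`
into statements about `[-t, ∞)`. -/
def reflect : ProjectionValuedMeasure 𝕜 E where
  proj s := P.proj (-s)
  isStarProjection s hs := P.isStarProjection _ hs.neg
  proj_univ := P.proj_univ
  proj_inter s t hs ht := P.proj_inter _ _ hs.neg ht.neg
  hasSum_iUnion f hf hd x := by
    rw [Set.iUnion_neg]
    exact P.hasSum_iUnion _ (fun n => (hf n).neg) (fun i j hij => (hd hij).preimage _) x

theorem scalarMeasure_reflect (x : E) : P.reflect.scalarMeasure x = (P.scalarMeasure x).neg := by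
  ext s hs
  rw [Measure.neg_apply, scalarMeasure_apply _ hs, scalarMeasure_apply _ hs.neg]
  rfl

variable [Fintype ι] (v : ι → E)

theorem traceMeasure_reflect : P.reflect.traceMeasure v = (P.traceMeasure v).neg := by
  ext s hs
  rw [Measure.neg_apply, traceMeasure_apply _ hs, traceMeasure_apply _ hs.neg]
  rfl

variable [DecidableEq ι]

theorem gramGap_reflect_Iic (t : ℝ) :
    P.reflect.gramGap v (Set.Iic t) = P.gramGap v (Set.Ici (-t)) := by
  rw [← Set.neg_Iic]
  rfl

theorem aemeasurable_inv_gramGap_Ici (m : Measure ℝ) :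
    AEMeasurable (fun t => (P.gramGap v (Set.Ici t))⁻¹) m := by
  have hreflect := (P.reflect.aemeasurable_inv_gramGap_Iic v m.neg).comp_measurable measurable_neg
  simpa only [Function.comp_def, gramGap_reflect_Iic, neg_neg] using hreflect

theorem integrableOn_Iic_div_gramGap {f : ℝ → ℝ} (hf : Continuous f)
    (hfν : Integrable f (P.traceMeasure v)) {a : ℝ}
    (h : IntegrableOn (fun t => (P.gramGap v (Set.Ici t))⁻¹) (Set.Iic a) (P.traceMeasure v)) :
    IntegrableOn (fun t => f t / P.gramGap v (Set.Ici t)) (Set.Iic a) (P.traceMeasure v) := by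
  have hreflect := P.reflect.integrableOn_Ici_div_gramGap v (f := fun t => f (-t)) (b := -a)
    (hf.comp continuous_neg)
  simp only [traceMeasure_reflect, integrableOn_Ici_neg_measure, gramGap_reflect_Iic,
    neg_neg] at hreflect
  exact hreflect (by simpa only [integrable_neg_measure, neg_neg] using hfν) h

theorem setIntegral_Iic_scalarMeasure_synthesis_le {f : ℝ → ℝ} {a : ℝ}
    (hf : ∀ t ∈ Set.Iic a, 0 ≤ f t)
    (h : IntegrableOn (fun t => f t / P.gramGap v (Set.Ici t)) (Set.Iic a) (P.traceMeasure v))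
    (x : EuclideanSpace 𝕜 ι) :
    ∫ t in Set.Iic a, f t ∂P.scalarMeasure (synthesis v x) ≤
      ‖synthesis v x‖ ^ 2 *
        ∫ t in Set.Iic a, f t / P.gramGap v (Set.Ici t) ∂P.traceMeasure v := by
  have hreflect := P.reflect.setIntegral_Ici_scalarMeasure_synthesis_le v (f := fun t => f (-t))
    (b := -a) (fun t ht => hf _ (Set.mem_Iic.2 (neg_le.1 ht)))
  simp only [traceMeasure_reflect, scalarMeasure_reflect, integrableOn_Ici_neg_measure,
    setIntegral_Ici_neg_measure, gramGap_reflect_Iic, neg_neg] at hreflect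
  exact hreflect h x

end Reflect

end ProjectionValuedMeasure

section CourantFischer

variable {𝕜 S S' κ : Type*} [RCLike 𝕜] [NormedAddCommGroup S] [InnerProductSpace 𝕜 S]
  [NormedAddCommGroup S'] [InnerProductSpace 𝕜 S'] [Fintype κ]

theorem mul_norm_sq_le_sum_mul_norm_inner_sq (b : OrthonormalBasis κ 𝕜 S) {μ : κ → ℝ} {c : ℝ}
    {u : S} (h : ∀ j, inner 𝕜 (b j) u ≠ 0 → c ≤ μ j) :
    c * ‖u‖ ^ 2 ≤ ∑ j, μ j * ‖inner 𝕜 (b j) u‖ ^ 2 := by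
  rw [← b.sum_sq_norm_inner_right u, Finset.mul_sum]
  refine Finset.sum_le_sum fun j _ => ?_
  rcases eq_or_ne (inner 𝕜 (b j) u) 0 with hj | hj
  · simp [hj]
  · gcongr
    exact h j hj

theorem sum_mul_norm_inner_sq_le_mul_norm_sq (b : OrthonormalBasis κ 𝕜 S) {μ : κ → ℝ} {c : ℝ}
    {u : S} (h : ∀ j, inner 𝕜 (b j) u ≠ 0 → μ j ≤ c) :
    ∑ j, μ j * ‖inner 𝕜 (b j) u‖ ^ 2 ≤ c * ‖u‖ ^ 2 := by
  have hneg := mul_norm_sq_le_sum_mul_norm_inner_sq b (μ := -μ) fun j hj => neg_le_neg (h j hj)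
  simpa only [Pi.neg_apply, neg_mul, Finset.sum_neg_distrib, neg_le_neg_iff] using hneg

-- The vanishing of `i'` coordinates of `T u` and of the last `n - 1 - i` coordinates of `u`
-- imposes fewer than `n` conditions.
theorem exists_rayleigh_le_and_le {n n' : ℕ} (b : OrthonormalBasis (Fin n) 𝕜 S)
    (b' : OrthonormalBasis (Fin n') 𝕜 S') {μ : Fin n → ℝ} {μ' : Fin n' → ℝ} (hμ : Antitone μ)
    (hμ' : Antitone μ') (T : S →ₗ[𝕜] S') {i : Fin n} {i' : Fin n'} (hi : (i' : ℕ) ≤ i) :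
    ∃ u ≠ 0, μ i * ‖u‖ ^ 2 ≤ ∑ j, μ j * ‖inner 𝕜 (b j) u‖ ^ 2 ∧
      ∑ j, μ' j * ‖inner 𝕜 (b' j) (T u)‖ ^ 2 ≤ μ' i' * ‖T u‖ ^ 2 := by
  let conditions : S →ₗ[𝕜] (Finset.Ioi i → 𝕜) × (Finset.Iio i' → 𝕜) :=
    (LinearMap.pi fun j => innerₛₗ 𝕜 (b j.1)).prod
      (LinearMap.pi fun k => innerₛₗ 𝕜 (b' k.1) ∘ₗ T)
  have hfew : Module.finrank 𝕜 ((Finset.Ioi i → 𝕜) × (Finset.Iio i' → 𝕜)) <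
      Module.finrank 𝕜 S := by
    rw [Module.finrank_prod, Module.finrank_fintype_fun_eq_card,
      Module.finrank_fintype_fun_eq_card, Module.finrank_eq_card_basis b.toBasis]
    simp only [Fintype.card_coe, Fin.card_Ioi, Fin.card_Iio, Fintype.card_fin]
    omega
  have := b.toBasis.finiteDimensional_of_finite
  obtain ⟨u, hu, hu0⟩ := (Submodule.ne_bot_iff _).1 (LinearMap.ker_ne_bot_of_finrank_lt hfew)
  have hzero : conditions u = 0 := LinearMap.mem_ker.1 hu
  have hhigh : ∀ j, i < j → inner 𝕜 (b j) u = 0 := fun j hj =>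
    congrFun (congrArg Prod.fst hzero) ⟨j, Finset.mem_Ioi.2 hj⟩
  have hlow : ∀ k, k < i' → inner 𝕜 (b' k) (T u) = 0 := fun k hk =>
    congrFun (congrArg Prod.snd hzero) ⟨k, Finset.mem_Iio.2 hk⟩
  exact ⟨u, hu0,
    mul_norm_sq_le_sum_mul_norm_inner_sq b fun j hj => hμ (not_lt.1 (mt (hhigh j) hj)),
    sum_mul_norm_inner_sq_le_mul_norm_sq b' fun k hk => hμ' (not_lt.1 (mt (hlow k) hk))⟩

end CourantFischer

section Ritz

variable {𝕜 E : Type*} [RCLike 𝕜] [NormedAddCommGroup E] [InnerProductSpace 𝕜 E] {M : ℕ}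
  {H : E →ₗ.[𝕜] E}

/-- The quadratic form `x ↦ ⟨x, H x⟩` of a partially defined operator on its domain. -/
noncomputable def energy (H : E →ₗ.[𝕜] E) (x : H.domain) : ℝ :=
  RCLike.re (inner 𝕜 (x : E) (H x))

theorem star_dotProduct_gramMatrix_mulVec (w : Fin M → H.domain) (x z : Fin M → 𝕜) :
    star x ⬝ᵥ (gramMatrix w).mulVec z =
      inner 𝕜 (Fintype.linearCombination 𝕜 w x) (Fintype.linearCombination 𝕜 w z) := by
  simp only [gramMatrix, Matrix.star_dotProduct_gram_mulVec, Submodule.coe_inner,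
    Fintype.linearCombination_apply, Submodule.coe_sum, Submodule.coe_smul]

theorem star_dotProduct_projectedMatrix_mulVec (w : Fin M → H.domain) (x z : Fin M → 𝕜) :
    star x ⬝ᵥ (projectedMatrix H w).mulVec z =
      inner 𝕜 (Fintype.linearCombination 𝕜 w x : E) (H (Fintype.linearCombination 𝕜 w z)) := by
  have hmap : H (Fintype.linearCombination 𝕜 w z) = ∑ l, z l • H (w l) := by
    simp only [← LinearPMap.toFun_eq_coe, Fintype.linearCombination_apply, map_sum, map_smul]
  rw [hmap]
  simp only [Fintype.linearCombination_apply, Submodule.coe_sum, Submodule.coe_smul,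
    sum_inner, inner_sum, inner_smul_left, inner_smul_right, dotProduct, Matrix.mulVec,
    projectedMatrix, Matrix.of_apply, Finset.mul_sum, Pi.star_apply, RCLike.star_def]
  rw [Finset.sum_comm]
  exact Finset.sum_congr rfl fun i _ => Finset.sum_congr rfl fun j _ => by ring

open scoped ComplexOrder in
theorem ker_mulVecLin_gramMatrix (w : Fin M → H.domain) :
    LinearMap.ker (gramMatrix w).mulVecLin = LinearMap.ker (Fintype.linearCombination 𝕜 w) := by
  ext z
  simp only [LinearMap.mem_ker, Matrix.mulVecLin_apply]
  refine ⟨fun h => ?_, fun h => ?_⟩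
  · rw [← inner_self_eq_zero (𝕜 := 𝕜), ← star_dotProduct_gramMatrix_mulVec, h, dotProduct_zero]
  · rw [← dotProduct_star_self_eq_zero, star_dotProduct_gramMatrix_mulVec, h, inner_zero_right]

theorem rank_gramMatrix (w : Fin M → H.domain) :
    (gramMatrix w).rank = Module.finrank 𝕜 (Submodule.span 𝕜 (Set.range w)) := by
  have hgram := (gramMatrix w).mulVecLin.finrank_range_add_finrank_ker
  have hw := (Fintype.linearCombination 𝕜 w).finrank_range_add_finrank_ker
  rw [ker_mulVecLin_gramMatrix] at hgram
  rw [Matrix.rank, ← Fintype.range_linearCombination]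
  omega

namespace IsProperEigenvalues

theorem exists_orthonormalBasis {w : Fin M → H.domain} {μ : ℕ → ℝ}
    (h : IsProperEigenvalues H w μ) :
    ∃ b : OrthonormalBasis (Fin (gramMatrix w).rank) 𝕜 (Submodule.span 𝕜 (Set.range w)),
      ∀ (u : Submodule.span 𝕜 (Set.range w)) j,
        inner 𝕜 ((u : H.domain) : E) (H (b j)) = (μ j : 𝕜) * inner 𝕜 u (b j) := by
  obtain ⟨x, horth, heig⟩ := h.exists_eigenvectors
  let y : Fin (gramMatrix w).rank → Submodule.span 𝕜 (Set.range w) := fun j =>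
    ⟨Fintype.linearCombination 𝕜 w (x j), Fintype.range_linearCombination 𝕜 w ▸ ⟨x j, rfl⟩⟩
  have hy : Orthonormal 𝕜 y := orthonormal_iff_ite.2 fun i j => by
    rw [← horth i j, star_dotProduct_gramMatrix_mulVec]
    rfl
  have := FiniteDimensional.span_of_finite 𝕜 (Set.finite_range w)
  have hspan : Submodule.span 𝕜 (Set.range y) = ⊤ :=
    hy.linearIndependent.span_eq_top_of_card_eq_finrank' (by
      rw [Fintype.card_fin, rank_gramMatrix])
  refine ⟨OrthonormalBasis.mk hy hspan.ge, fun ⟨u, hu⟩ j => ?_⟩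
  rw [← Fintype.range_linearCombination] at hu
  obtain ⟨z, rfl⟩ := hu
  rw [OrthonormalBasis.coe_mk, ← star_dotProduct_projectedMatrix_mulVec, heig, dotProduct_smul,
    star_dotProduct_gramMatrix_mulVec, smul_eq_mul]
  rfl

theorem exists_orthonormalBasis_energy_eq {w : Fin M → H.domain} {μ : ℕ → ℝ}
    (h : IsProperEigenvalues H w μ) :
    ∃ b : OrthonormalBasis (Fin (gramMatrix w).rank) 𝕜 (Submodule.span 𝕜 (Set.range w)),
      ∀ u : Submodule.span 𝕜 (Set.range w),
        energy H u = ∑ j : Fin (gramMatrix w).rank, μ j * ‖inner 𝕜 (b j) u‖ ^ 2 := by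
  obtain ⟨b, hb⟩ := h.exists_orthonormalBasis
  refine ⟨b, fun u => ?_⟩
  have hmap : H u = ∑ j, inner 𝕜 (b j) u • H (b j) := by
    conv_lhs => rw [← b.sum_repr' u]
    simp only [← LinearPMap.toFun_eq_coe, Submodule.coe_sum, Submodule.coe_smul, map_sum, map_smul]
  have hinner : inner 𝕜 ((u : H.domain) : E) (H u) =
      ((∑ j : Fin (gramMatrix w).rank, μ j * ‖inner 𝕜 (b j) u‖ ^ 2 : ℝ) : 𝕜) := by
    rw [hmap, inner_sum]
    push_cast
    refine Finset.sum_congr rfl fun j _ => ?_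
    rw [inner_smul_right, hb, mul_left_comm, ← inner_conj_symm u, RCLike.mul_conj]
  rw [energy, hinner, RCLike.ofReal_re]

theorem exists_energy_eq_and_norm_eq_one {w : Fin M → H.domain} {μ : ℕ → ℝ}
    (h : IsProperEigenvalues H w μ) {i : ℕ} (hi : i < (gramMatrix w).rank) :
    ∃ u ∈ Submodule.span 𝕜 (Set.range w), energy H u = μ i ∧ ‖u‖ = 1 := by
  obtain ⟨b, hb⟩ := h.exists_orthonormalBasis_energy_eq
  refine ⟨b ⟨i, hi⟩, (b ⟨i, hi⟩).2, ?_, b.norm_eq_one ⟨i, hi⟩⟩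
  simp [hb, OrthonormalBasis.inner_eq_ite, apply_ite]

theorem exists_le_energy_and_energy_le {w w' : Fin M → H.domain} {μ μ' : ℕ → ℝ}
    (h : IsProperEigenvalues H w μ) (h' : IsProperEigenvalues H w' μ')
    (T : Submodule.span 𝕜 (Set.range w) →ₗ[𝕜] Submodule.span 𝕜 (Set.range w')) {i : ℕ}
    (hi : i < (gramMatrix w).rank) (hi' : i < (gramMatrix w').rank) :
    ∃ u : Submodule.span 𝕜 (Set.range w), u ≠ 0 ∧ μ i * ‖u‖ ^ 2 ≤ energy H u ∧
      energy H (T u) ≤ μ' i * ‖T u‖ ^ 2 := by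
  obtain ⟨b, hb⟩ := h.exists_orthonormalBasis_energy_eq
  obtain ⟨b', hb'⟩ := h'.exists_orthonormalBasis_energy_eq
  simp only [hb, hb']
  exact exists_rayleigh_le_and_le b b' (i := ⟨i, hi⟩) (i' := ⟨i, hi'⟩)
    (fun j k hjk => h.antitone j k hjk k.2) (fun j k hjk => h'.antitone j k hjk k.2) T le_rfl

end IsProperEigenvalues

theorem exists_synthesis_eq_of_mem_span {v : Fin M → H.domain} {x : H.domain}
    (hx : x ∈ Submodule.span 𝕜 (Set.range v)) :
    ∃ z : EuclideanSpace 𝕜 (Fin M), synthesis (fun l => (v l : E)) z = x := by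
  obtain ⟨c, rfl⟩ := Submodule.mem_span_range_iff_exists_fun 𝕜 |>.1 hx
  exact ⟨WithLp.toLp 2 c, by simp [synthesis_apply]⟩

end Ritz

section Signal

variable {𝕜 E : Type*} [RCLike 𝕜] [NormedAddCommGroup E] [InnerProductSpace 𝕜 E]
  [CompleteSpace E] {M : ℕ} {H : E →ₗ.[𝕜] E} {P : ProjectionValuedMeasure 𝕜 E}

namespace IsSpectralResolution

theorem integrable_id (hP : IsSpectralResolution H P) (x : H.domain) :
    Integrable (fun t : ℝ => t) (P.scalarMeasure (x : E)) := by
  refine Integrable.mono' (((hP.mem_domain_iff _).1 x.2).add (integrable_const 1))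
    measurable_id.aestronglyMeasurable (ae_of_all _ fun t => ?_)
  simp only [Real.norm_eq_abs, Pi.add_apply]
  nlinarith [sq_abs t, sq_nonneg (|t| - 1)]

theorem integrable_sub_const (hP : IsSpectralResolution H P) (x : H.domain) (c : ℝ) :
    Integrable (fun t : ℝ => t - c) (P.scalarMeasure (x : E)) :=
  (hP.integrable_id x).sub (integrable_const c)

theorem integrable_sub_const_spectralMeasure (hP : IsSpectralResolution H P)
    (v : Fin M → H.domain) (c : ℝ) :
    Integrable (fun t : ℝ => t - c) (spectralMeasure P v) :=
  integrable_finsetSum_measure.2 fun l _ => hP.integrable_sub_const (v l) c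

theorem energy_sub_mul_norm_sq (hP : IsSpectralResolution H P) (x : H.domain) (c : ℝ) :
    energy H x - c * ‖x‖ ^ 2 = ∫ t, (t - c) ∂P.scalarMeasure (x : E) := by
  rw [integral_sub (hP.integrable_id x) (integrable_const c), integral_const, smul_eq_mul,
    P.scalarMeasure_real_univ, energy, hP.inner_apply, RCLike.ofReal_re, mul_comm,
    Submodule.coe_norm]

/-- The spectral projection `P(I)`, restricted to the domain of the operator. -/
def projOnDomain (hP : IsSpectralResolution H P) {I : Set ℝ} (hI : MeasurableSet I) :
    H.domain →ₗ[𝕜] H.domain :=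
  (P.proj I).toLinearMap.restrict fun x hx => hP.proj_mem_domain hI ⟨x, hx⟩

theorem energy_projOnDomain_sub_mul_norm_sq (hP : IsSpectralResolution H P) {I : Set ℝ}
    (hI : MeasurableSet I) (x : H.domain) (c : ℝ) :
    energy H (hP.projOnDomain hI x) - c * ‖hP.projOnDomain hI x‖ ^ 2 =
      ∫ t in I, (t - c) ∂P.scalarMeasure (x : E) := by
  rw [← P.scalarMeasure_proj hI]
  exact hP.energy_sub_mul_norm_sq _ c

theorem exists_surjective_span_projectedGuess (hP : IsSpectralResolution H P)
    (v : Fin M → H.domain) {I : Set ℝ} (hI : MeasurableSet I) :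
    ∃ Q : Submodule.span 𝕜 (Set.range v) →ₗ[𝕜]
        Submodule.span 𝕜 (Set.range (projectedGuess hP v I hI)),
      Function.Surjective Q ∧ ∀ x, (Q x : H.domain) = hP.projOnDomain hI x := by
  have hspan : (Submodule.span 𝕜 (Set.range v)).map (hP.projOnDomain hI) =
      Submodule.span 𝕜 (Set.range (projectedGuess hP v I hI)) := by
    rw [Submodule.map_span, ← Set.range_comp]
    rfl
  refine ⟨(hP.projOnDomain hI).restrict fun x hx => hspan ▸ Submodule.mem_map_of_mem hx,
    fun ⟨y, hy⟩ => ?_, fun x => rfl⟩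
  obtain ⟨x, hx, rfl⟩ := hspan.symm ▸ hy
  exact ⟨⟨x, hx⟩, rfl⟩

end IsSpectralResolution

theorem rank_gramMatrix_projectedGuess_le (hP : IsSpectralResolution H P) (v : Fin M → H.domain)
    {I : Set ℝ} (hI : MeasurableSet I) :
    (gramMatrix (projectedGuess hP v I hI)).rank ≤ (gramMatrix v).rank := by
  have := FiniteDimensional.span_of_finite 𝕜 (Set.finite_range v)
  obtain ⟨Q, hQ, -⟩ := hP.exists_surjective_span_projectedGuess v hI
  rw [rank_gramMatrix, rank_gramMatrix]
  exact LinearMap.finrank_le_finrank_of_surjective hQ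

namespace IsProperEigenvalues

theorem exists_sub_mul_norm_sq_le {hP : IsSpectralResolution H P} {v : Fin M → H.domain}
    {I : Set ℝ} {hI : MeasurableSet I} {μV μB : ℕ → ℝ} (hμV : IsProperEigenvalues H v μV)
    (hμB : IsProperEigenvalues H (projectedGuess hP v I hI) μB) {i : ℕ}
    (hi : i < (gramMatrix (projectedGuess hP v I hI)).rank) :
    ∃ x ∈ Submodule.span 𝕜 (Set.range v), x ≠ 0 ∧
      (μV i - μB i) * ‖x‖ ^ 2 ≤ ∫ t in Iᶜ, (t - μB i) ∂P.scalarMeasure (x : E) := by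
  obtain ⟨Q, -, hQ⟩ := hP.exists_surjective_span_projectedGuess v hI
  obtain ⟨x, hx0, hle, hge⟩ := hμV.exists_le_energy_and_energy_le hμB Q
    (hi.trans_le (rank_gramMatrix_projectedGuess_le hP v hI)) hi
  refine ⟨x, x.2, by simpa using hx0, ?_⟩
  have htotal := hP.energy_sub_mul_norm_sq x (μB i)
  have hinside := hP.energy_projOnDomain_sub_mul_norm_sq hI x (μB i)
  rw [← integral_add_compl hI (hP.integrable_sub_const x _)] at htotal
  rw [← hQ] at hinside
  rw [Submodule.coe_norm] at hle hge
  linarith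

theorem exists_le_sub_mul_norm_sq {hP : IsSpectralResolution H P} {v : Fin M → H.domain}
    {I : Set ℝ} {hI : MeasurableSet I} {μV μB : ℕ → ℝ} (hμV : IsProperEigenvalues H v μV)
    (hμB : IsProperEigenvalues H (projectedGuess hP v I hI) μB) {i : ℕ}
    (hi : i < (gramMatrix (projectedGuess hP v I hI)).rank) :
    ∃ x ∈ Submodule.span 𝕜 (Set.range v), x ≠ 0 ∧
      ∫ t in Iᶜ, (t - μB i) ∂P.scalarMeasure (x : E) ≤ (μV i - μB i) * ‖x‖ ^ 2 := by
  obtain ⟨Q, hsurj, hQ⟩ := hP.exists_surjective_span_projectedGuess v hI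
  obtain ⟨T, hT⟩ := Q.exists_rightInverse_of_surjective (LinearMap.range_eq_top.2 hsurj)
  obtain ⟨u, hu0, hle, hge⟩ := hμB.exists_le_energy_and_energy_le hμV T hi
    (hi.trans_le (rank_gramMatrix_projectedGuess_le hP v hI))
  have hQT : Q (T u) = u := LinearMap.congr_fun hT u
  refine ⟨T u, (T u).2, fun h => hu0 ?_, ?_⟩
  · rw [← hQT, (Submodule.coe_eq_zero).1 h, map_zero]
  · have htotal := hP.energy_sub_mul_norm_sq (T u) (μB i)
    have hinside := hP.energy_projOnDomain_sub_mul_norm_sq hI (T u) (μB i)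
    rw [← integral_add_compl hI (hP.integrable_sub_const (T u) _)] at htotal
    rw [← hQ, hQT] at hinside
    rw [Submodule.coe_norm] at hle hge
    linarith

theorem mem_Ioo_of_projectedGuess {hP : IsSpectralResolution H P} {v : Fin M → H.domain}
    {a b : ℝ} {μB : ℕ → ℝ}
    (hμB : IsProperEigenvalues H (projectedGuess hP v (Set.Ioo a b) measurableSet_Ioo) μB) {i : ℕ}
    (hi : i < (gramMatrix (projectedGuess hP v (Set.Ioo a b) measurableSet_Ioo)).rank) :
    μB i ∈ Set.Ioo a b := by
  obtain ⟨u, hu, henergy, hnorm⟩ := hμB.exists_energy_eq_and_norm_eq_one hi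
  have hI : MeasurableSet (Set.Ioo a b) := measurableSet_Ioo
  obtain ⟨Q, hsurj, hQ⟩ := hP.exists_surjective_span_projectedGuess v hI
  obtain ⟨x, hx⟩ := hsurj ⟨u, hu⟩
  have hux : hP.projOnDomain hI (x : H.domain) = u := by rw [← hQ, hx]
  have hmass : P.scalarMeasure ((x : H.domain) : E) (Set.Ioo a b) ≠ 0 := by
    rw [Ne, P.scalarMeasure_eq_zero_iff hI, ← norm_eq_zero]
    exact ((congrArg norm hux).trans hnorm).trans_ne one_ne_zero
  have hmean : ∀ c, μB i - c = ∫ t in Set.Ioo a b, (t - c) ∂P.scalarMeasure (x : E) := fun c => by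
    rw [← hP.energy_projOnDomain_sub_mul_norm_sq hI, hux, henergy, hnorm, one_pow, mul_one]
  constructor
  · rw [← sub_pos, hmean]
    exact setIntegral_pos hI hmass (fun t ht => sub_pos.2 ht.1)
      (hP.integrable_sub_const x a).integrableOn
  · rw [← neg_lt_neg_iff, ← sub_pos, neg_sub_neg, ← neg_sub, hmean, ← integral_neg]
    exact setIntegral_pos hI hmass (fun t ht => neg_pos.2 (sub_neg.2 ht.2))
      (hP.integrable_sub_const x b).integrableOn.neg

theorem sub_le_setIntegral_Ici {hP : IsSpectralResolution H P} {v : Fin M → H.domain} {a b : ℝ}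
    {μV μB : ℕ → ℝ} (hμV : IsProperEigenvalues H v μV)
    (hμB : IsProperEigenvalues H (projectedGuess hP v (Set.Ioo a b) measurableSet_Ioo) μB) {i : ℕ}
    (hi : i < (gramMatrix (projectedGuess hP v (Set.Ioo a b) measurableSet_Ioo)).rank)
    (hint : IntegrableOn (fun t => (t - μB i) / lambdaUp hP v t) (Set.Ici b)
      (spectralMeasure P v)) :
    μV i - μB i ≤ ∫ t in Set.Ici b, (t - μB i) / lambdaUp hP v t ∂spectralMeasure P v := by
  obtain ⟨ha, hb⟩ := hμB.mem_Ioo_of_projectedGuess hi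
  obtain ⟨x, hx, hx0, hle⟩ := hμV.exists_sub_mul_norm_sq_le hμB hi
  obtain ⟨z, hz⟩ := exists_synthesis_eq_of_mem_span hx
  have htail : ∫ t in Set.Ici b, (t - μB i) ∂P.scalarMeasure (x : E) ≤
      ‖x‖ ^ 2 * ∫ t in Set.Ici b, (t - μB i) / lambdaUp hP v t ∂spectralMeasure P v := by
    rw [Submodule.coe_norm, ← hz]
    exact P.setIntegral_Ici_scalarMeasure_synthesis_le _
      (fun t ht => sub_nonneg.2 (hb.le.trans ht)) hint z
  have hlow : ∫ t in Set.Iic a, (t - μB i) ∂P.scalarMeasure (x : E) ≤ 0 :=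
    setIntegral_nonpos measurableSet_Iic fun t ht => sub_nonpos.2 (ht.trans ha.le)
  rw [setIntegral_compl_Ioo (hP.integrable_sub_const x _) (ha.trans hb)] at hle
  exact le_of_mul_le_mul_right (by linarith) (by positivity : 0 < ‖x‖ ^ 2)

theorem setIntegral_Iic_le_sub {hP : IsSpectralResolution H P} {v : Fin M → H.domain} {a b : ℝ}
    {μV μB : ℕ → ℝ} (hμV : IsProperEigenvalues H v μV)
    (hμB : IsProperEigenvalues H (projectedGuess hP v (Set.Ioo a b) measurableSet_Ioo) μB) {i : ℕ}
    (hi : i < (gramMatrix (projectedGuess hP v (Set.Ioo a b) measurableSet_Ioo)).rank)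
    (hint : IntegrableOn (fun t => (t - μB i) / lambdaDown hP v t) (Set.Iic a)
      (spectralMeasure P v)) :
    ∫ t in Set.Iic a, (t - μB i) / lambdaDown hP v t ∂spectralMeasure P v ≤ μV i - μB i := by
  obtain ⟨ha, hb⟩ := hμB.mem_Ioo_of_projectedGuess hi
  obtain ⟨x, hx, hx0, hle⟩ := hμV.exists_le_sub_mul_norm_sq hμB hi
  obtain ⟨z, hz⟩ := exists_synthesis_eq_of_mem_span hx
  have htail : ‖x‖ ^ 2 * ∫ t in Set.Iic a, (t - μB i) / lambdaDown hP v t ∂spectralMeasure P v ≤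
      ∫ t in Set.Iic a, (t - μB i) ∂P.scalarMeasure (x : E) := by
    have hneg := P.setIntegral_Iic_scalarMeasure_synthesis_le (fun l => (v l : E))
      (f := fun t => -(t - μB i)) (fun t ht => neg_nonneg.2 (sub_nonpos.2 (ht.trans ha.le)))
      (by simp only [neg_div]; exact hint.neg) z
    simp only [neg_div, integral_neg, mul_neg, neg_le_neg_iff, hz] at hneg
    exact hneg
  have hhigh : 0 ≤ ∫ t in Set.Ici b, (t - μB i) ∂P.scalarMeasure (x : E) :=
    setIntegral_nonneg measurableSet_Ici fun t ht => sub_nonneg.2 (hb.le.trans ht)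
  rw [setIntegral_compl_Ioo (hP.integrable_sub_const x _) (ha.trans hb)] at hle
  exact le_of_mul_le_mul_right (by linarith) (by positivity : 0 < ‖x‖ ^ 2)

end IsProperEigenvalues

end Signal

theorem mainTheorem7_general {𝕜 E : Type*} [RCLike 𝕜] [NormedAddCommGroup E]
    [InnerProductSpace 𝕜 E] [CompleteSpace E] {M : ℕ}
    (H : E →ₗ.[𝕜] E) (P : ProjectionValuedMeasure 𝕜 E) (hP : IsSpectralResolution H P)
    (v : Fin M → H.domain) (Ea Eb : ℝ)
    (B : Fin M → H.domain) (hB : B = projectedGuess hP v (Set.Ioo Ea Eb) measurableSet_Ioo)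
    (μV μB : ℕ → ℝ) (hμV : IsProperEigenvalues H v μV) (hμB : IsProperEigenvalues H B μB)
    (i : ℕ) (hi : i < (gramMatrix B).rank) :
    (∫⁻ t in Set.Ici Eb, (ENNReal.ofReal (lambdaUp hP v t))⁻¹ ∂spectralMeasure P v ≠ ⊤ →
      IntegrableOn (fun t => (t - μB i) / lambdaUp hP v t) (Set.Ici Eb) (spectralMeasure P v) ∧
      μV i - μB i ≤
        ∫ t in Set.Ici Eb, (t - μB i) / lambdaUp hP v t ∂spectralMeasure P v) ∧
    (∫⁻ t in Set.Iic Ea, (ENNReal.ofReal (lambdaDown hP v t))⁻¹ ∂spectralMeasure P v ≠ ⊤ →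
      IntegrableOn (fun t => (t - μB i) / lambdaDown hP v t) (Set.Iic Ea) (spectralMeasure P v) ∧
      ∫ t in Set.Iic Ea, (t - μB i) / lambdaDown hP v t ∂spectralMeasure P v ≤
        μV i - μB i) := by
  subst hB
  have hcont : Continuous fun t => t - μB i := continuous_id.sub continuous_const
  have hν := hP.integrable_sub_const_spectralMeasure v (μB i)
  refine ⟨fun hup => ?_, fun hdown => ?_⟩
  · have hint := P.integrableOn_Ici_div_gramGap (fun l => (v l : E)) hcont hν
      (integrable_inv_of_lintegral_inv_ofReal_ne_top (P.aemeasurable_inv_gramGap_Iic _ _) hup)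
    exact ⟨hint, hμV.sub_le_setIntegral_Ici hμB hi hint⟩
  · have hint := P.integrableOn_Iic_div_gramGap (fun l => (v l : E)) hcont hν
      (integrable_inv_of_lintegral_inv_ofReal_ne_top (P.aemeasurable_inv_gramGap_Ici _ _) hdown)
    exact ⟨hint, hμV.setIntegral_Iic_le_sub hμB hi hint⟩

theorem mainTheorem7 {𝕜 E : Type*} [RCLike 𝕜] [NormedAddCommGroup E] [InnerProductSpace 𝕜 E]
    [CompleteSpace E] {M : ℕ}
    (H : E →ₗ.[𝕜] E) (P : ProjectionValuedMeasure 𝕜 E) (hP : IsSpectralResolution H P)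
    (v : Fin M → H.domain) (Ea Eb : ℝ) (hsignal : IsSignal hP v Ea Eb)
    (B : Fin M → H.domain) (hB : B = projectedGuess hP v (Set.Ioo Ea Eb) measurableSet_Ioo)
    (μV μB : ℕ → ℝ) (hμV : IsProperEigenvalues H v μV) (hμB : IsProperEigenvalues H B μB)
    (i : ℕ) (hi : i < (gramMatrix B).rank) :
    (IntegrableOn (fun t => (t - μB i) / lambdaUp hP v t) (Set.Ici Eb) (spectralMeasure P v) ∧
      μV i - μB i ≤
        ∫ t in Set.Ici Eb, (t - μB i) / lambdaUp hP v t ∂spectralMeasure P v) ∧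
    (IntegrableOn (fun t => (t - μB i) / lambdaDown hP v t) (Set.Iic Ea) (spectralMeasure P v) ∧
      ∫ t in Set.Iic Ea, (t - μB i) / lambdaDown hP v t ∂spectralMeasure P v ≤
        μV i - μB i) :=
  (mainTheorem7_general H P hP v Ea Eb B hB μV μB hμV hμB i hi).imp
    (· (ne_top_of_le_ne_top ENNReal.one_ne_top hsignal.upper))
    (· (ne_top_of_le_ne_top ENNReal.one_ne_top hsignal.lower))
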